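/- **Definitions.** For probability measures $P,Q$ on a space $\mathcal X$, a distance function $\mathbf d$ on $\mathcal X$ and $\epsilon>0$, let $\mathrm{PV}(P,Q,\epsilon,\mathbf d)=\inf_\mu \mu(\{(x,y):\mathbf d(x,y)>\epsilon\})$, the infimum over all couplings $\mu$ of $P$ and $Q$. For two samples $x_1,\dots,x_n$ and $y_1,\dots,y_m$ let $\widehat{\mathrm{PV}}$ be the minimum of $\frac1{2n}\sum_i w_i+\frac1{2m}\sum_j v_j$ over $w_i,v_j,Z_{ij}\ge 0$ with $Z_{ij}=0$ whenever $\mathbf d(x_i,y_j)>\epsilon$, and $\sum_{j}Z_{ij}+w_i=1$, $\sum_{i}Z_{ij}+v_j=1$ for all $i,j$. On $\mathbb R$ the distance is $|a-b|$. **Setting.** Let $P,Q$ be probability distributions on $[0,1]^d$ with distance function $\mathbf d$, let $\epsilon\in(0,1)$, and let $f:\mathbb R^d\to\mathbb R$ be a (jointly measurable) random mapping, with i.i.d. copies $f_1,f_2,\dots$. Write $\mathrm{PV}_1=\mathrm{PV}(f(X),f(Y),\epsilon)$ for the perturbed variation between the images of $X\sim P$ and $Y\sim Q$ under $f$, a quantity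 that is random through $f$, and $\mathrm{PPV}_K=\max_{i\le K}\mathrm{PV}(f_i(X),f_i(Y),\epsilon)$. Assume that $P$ and $Q$ are *1D distinguishable*: $\mathrm{PV}(P,Q,\epsilon,\mathbf d)>0$ and $\lim_{K\to\infty}\mathrm{PPV}_K>0$ almost surely. For integers $K,n,m\ge1$ and $\delta\in(0,1)$ put $N=\min(n,m)$ and $$\tilde\eta=\tilde\eta(K,n,m,\delta)=\sqrt{\frac{2\log\left(2K(2^{1/\epsilon}-2)/\delta\right)}{N}}$$ (read as $0$ if the logarithm is negative). **Theorem.** Let $L$ be the essential supremum of $\mathrm{PV}_1$ over the random mapping $f$. Then $L>0$, and for every $t<L/2$ there is $q\in(0,1)$ such that for all $K,n,m\ge 1$ and all $\delta\in(0,1)$ with $\tilde\eta(K,n,m,\delta)\le t$ the following holds. If $S_{i1}=\{x_{i1},\dots,x_{in}\}\sim P$ and $S_{i2}=\{y_{i1},\dots,y_{im}\}\sim Q$, $i=1,\dots,K$, are i.i.d. samples, all independent of each other and of $f_1,\dots,f_K$, then with probability at least $1-(q-q\delta+\delta)^K$ $$\max_{1\le i\le K}\widehat{\mathrm{PV}}\left(f_i(S_{i1}),f_i(S_{i2}),\epsilon\right)\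 \ge\ \sqrt{\frac{2\log\left(2K(2^{1/\epsilon}-2)/\delta\right)}{N}} ,$$ where $0<q-q\delta+\delta<1$. In particular $q$ does not depend on $K,n,m,\delta$, and the failure probability decays exponentially in $K$ in this range. -/

import Mathlib

open MeasureTheory Filter Topology

noncomputable section

/-- The joint distributions on `X × X` with marginals `P` and `Q`. -/
def couplings {X : Type*} [MeasurableSpace X] (P Q : Measure X) : Set (Measure (X × X)) :=
  {μ | μ.fst = P ∧ μ.snd = Q}

/-- The perturbed variation `PV(P, Q, ε, D)`: the infimum, over all joint distributions `μ` with
marginals `P` and `Q`, of the probability under `μ` of the event `D(X, Y) > ε`. -/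
def PV {X : Type*} [MeasurableSpace X] (D : X → X → ℝ) (P Q : Measure X) (ε : ℝ) : ℝ :=
  sInf ((fun μ : Measure (X × X) => μ.real {p | ε < D p.1 p.2}) '' couplings P Q)

/-- The constraints of the linear program that defines the empirical perturbed variation of the
samples `x` and `y`. -/
structure EmpPVFeasible {X : Type*} (D : X → X → ℝ) (ε : ℝ) {n m : ℕ} (x : Fin n → X)
    (y : Fin m → X) (w : Fin n → ℝ) (v : Fin m → ℝ) (Z : Fin n → Fin m → ℝ) : Prop where
  w_nonneg : ∀ i, 0 ≤ w i
  v_nonneg : ∀ j, 0 ≤ v j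
  Z_nonneg : ∀ i j, 0 ≤ Z i j
  row : ∀ i, (∑ j with D (x i) (y j) ≤ ε, Z i j) + w i = 1
  col : ∀ j, (∑ i with D (x i) (y j) ≤ ε, Z i j) + v j = 1
  far : ∀ i j, ε < D (x i) (y j) → Z i j = 0

/-- The empirical perturbed variation of two samples: the optimal value of the linear program. -/
def empPV {X : Type*} (D : X → X → ℝ) {n m : ℕ} (x : Fin n → X) (y : Fin m → X) (ε : ℝ) : ℝ :=
  sInf {r | ∃ w v Z, EmpPVFeasible D ε x y w v Z ∧
    r = 1 / (2 * (n : ℝ)) * ∑ i, w i + 1 / (2 * (m : ℝ)) * ∑ j, v j}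

/-- The usual distance on the real line. -/
def absDist (a b : ℝ) : ℝ := |a - b|

/-- `PV(g(X), g(Y), ε)` for `X ∼ P`, `Y ∼ Q` and a mapping `g` into the real line. -/
def projPV {E : Type*} [MeasurableSpace E] (P Q : Measure E) (ε : ℝ) (g : E → ℝ) : ℝ :=
  PV absDist (P.map g) (Q.map g) ε

/-- The maximum projected score `PPV_K(P, Q, ε)` along the first `K` mappings of a sequence. -/
def PPV {E : Type*} [MeasurableSpace E] (P Q : Measure E) (ε : ℝ) (g : ℕ → E → ℝ) (K : ℕ) : ℝ :=
  ⨆ i : Fin K, projPV P Q ε (g i)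

/-- The empirical maximum projected score of `K` sample pairs, the `i`-th pair `(x i, y i)` being
projected by its own mapping `g i`. -/
def empPPV {E : Type*} {K n m : ℕ} (g : Fin K → E → ℝ) (x : Fin K → Fin n → E)
    (y : Fin K → Fin m → E) (ε : ℝ) : ℝ :=
  ⨆ i : Fin K, empPV absDist (fun j => g i (x i j)) (fun j => g i (y i j)) ε

/-- `P` and `Q` are 1D distinguishable, with respect to the random mapping `f θ`, `θ ∼ ρ`, if
`PV(P, Q, ε, D) > 0` and, for an i.i.d. sequence of such mappings, `lim_K PPV_K(P, Q, ε) > 0`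
almost surely. -/
def OneDimDistinguishable {E Θ : Type*} [MeasurableSpace E] [MeasurableSpace Θ] (D : E → E → ℝ)
    (P Q : Measure E) (ε : ℝ) (ρ : Measure Θ) [IsProbabilityMeasure ρ] (f : Θ → E → ℝ) : Prop :=
  0 < PV D P Q ε ∧
  ∀ᵐ θ ∂(Measure.infinitePi fun _ : ℕ => ρ),
    ∃ l : ℝ, 0 < l ∧ Tendsto (fun K => PPV P Q ε (fun i => f (θ i)) K) atTop (𝓝 l)

/-- The joint law of a random projection and, independently of it, an i.i.d. sample of size `n`
from `P` and an i.i.d. sample of size `m` from `Q`. -/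
def trialLaw {E Θ : Type*} [MeasurableSpace E] [MeasurableSpace Θ] (P Q : Measure E)
    (ρ : Measure Θ) (n m : ℕ) : Measure (Θ × (Fin n → E) × (Fin m → E)) :=
  ρ.prod ((Measure.pi fun _ : Fin n => P).prod (Measure.pi fun _ : Fin m => Q))

/-- The threshold `√(2 log(2K(2^{1/ε} - 2)/δ) / N)` with `N = min(n, m)`. -/
def threshold (ε : ℝ) (K n m : ℕ) (δ : ℝ) : ℝ :=
  Real.sqrt (2 * Real.log (2 * (K : ℝ) * ((2 : ℝ) ^ (1 / ε) - 2) / δ) / ((min n m : ℕ) : ℝ))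

end

/-! No concentration inequality is needed. If the empirical value of two samples is below `t`, some
fractional matching of their close pairs has mass at least `(1 - 2t) * max n m`. Averaging these
matchings over the samples and dividing by `max n m` gives a measure on close pairs whose marginals
lie below `p` and `q`; completing it to a coupling yields `PV ≤ 1 - (1 - 2t) * ℙ(empPV < t)`, for
all sample sizes (`PV_le_of_measure_empPV_lt`).

Now let `2t < s < L`. A projection has score above `s` with positive probability `a`, and then a
trial falls below `t` with probability at most `c = (1 - s) / (1 - 2t) < 1`. So each trial fails
with probability at most `q = 1 - a(1 - c) < 1`, and `K` independent trials all fail with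
probability at most `q ^ K`. The stated bound is weaker, as `q ≤ q - qδ + δ`; the form of the
threshold plays no role beyond being at most `t`. -/

/-! ### Completing partial couplings -/

/-- The missing marginals have equal mass, so their normalised product completes `μ₀` to a coupling,
which can only gain mass on close pairs. -/
theorem PV_le_of_subcoupling {X : Type*} [MeasurableSpace X] {D : X → X → ℝ} {ε : ℝ}
    (hD : MeasurableSet {z : X × X | ε < D z.1 z.2}) {p q : Measure X}
    [IsProbabilityMeasure p] [IsProbabilityMeasure q] (μ₀ : Measure (X × X))
    (h1 : μ₀.fst ≤ p) (h2 : μ₀.snd ≤ q) :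
    PV D p q ε ≤ 1 - μ₀.real {z | ε < D z.1 z.2}ᶜ := by
  have : IsFiniteMeasure μ₀ := by
    constructor
    rw [← Measure.fst_univ]
    exact (h1 _).trans_lt (measure_lt_top _ _)
  have ha : (p - μ₀.fst) + μ₀.fst = p := Measure.sub_add_cancel_of_le h1
  have hb : (q - μ₀.snd) + μ₀.snd = q := Measure.sub_add_cancel_of_le h2
  set a := p - μ₀.fst
  set b := q - μ₀.snd
  have : IsFiniteMeasure a := isFiniteMeasure_of_le p (ha ▸ Measure.le_add_right le_rfl)
  have : IsFiniteMeasure b := isFiniteMeasure_of_le q (hb ▸ Measure.le_add_right le_rfl)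
  have hab : a Set.univ = b Set.univ := by
    have e1 : a Set.univ + μ₀ Set.univ = 1 := by
      rw [← Measure.fst_univ, ← Measure.add_apply, ha, measure_univ]
    have e2 : b Set.univ + μ₀ Set.univ = 1 := by
      rw [← Measure.snd_univ, ← Measure.add_apply, hb, measure_univ]
    exact (ENNReal.add_left_inj (measure_ne_top μ₀ _)).1 (e1.trans e2.symm)
  -- If the residual mass is zero, the normalising factor is `⊤`, but the measure it multiplies
  -- vanishes.
  have key : ∀ ν : Measure X, ν Set.univ = a Set.univ →
      (a Set.univ)⁻¹ • a Set.univ • ν = ν := by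
    intro ν hν
    by_cases h0 : a Set.univ = 0
    · rw [h0] at hν
      rw [Measure.measure_univ_eq_zero.1 hν]; simp
    · rw [smul_smul, ENNReal.inv_mul_cancel h0 (measure_ne_top _ _), one_smul]
  let μ := μ₀ + (a Set.univ)⁻¹ • a.prod b
  have hμ1 : μ.fst = p := by
    rw [← ha, add_comm]
    simp only [μ, Measure.fst, Measure.map_add _ _ measurable_fst, Measure.map_smul]
    congr 1
    rw [Measure.map_fst_prod, ← hab, key _ rfl]
  have hμ2 : μ.snd = q := by
    rw [← hb, add_comm]
    simp only [μ, Measure.snd, Measure.map_add _ _ measurable_snd, Measure.map_smul]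
    congr 1
    rw [Measure.map_snd_prod, key _ hab.symm]
  have : IsProbabilityMeasure μ := ⟨by rw [← Measure.fst_univ, hμ1, measure_univ]⟩
  have hle : PV D p q ε ≤ μ.real {z | ε < D z.1 z.2} :=
    csInf_le ⟨0, by rintro _ ⟨_, _, rfl⟩; exact measureReal_nonneg⟩ ⟨μ, ⟨hμ1, hμ2⟩, rfl⟩
  have hmono : μ₀.real {z | ε < D z.1 z.2}ᶜ ≤ μ.real {z | ε < D z.1 z.2}ᶜ :=
    ENNReal.toReal_mono (measure_ne_top _ _) (Measure.le_add_right le_rfl _)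
  rw [probReal_compl_eq_one_sub (μ := μ) hD] at hmono
  linarith

theorem PV_nonneg {X : Type*} [MeasurableSpace X] (D : X → X → ℝ) (p q : Measure X) (ε : ℝ) :
    0 ≤ PV D p q ε :=
  Real.sInf_nonneg (by rintro _ ⟨_, _, rfl⟩; exact measureReal_nonneg)

theorem PV_le_one {X : Type*} [MeasurableSpace X] {D : X → X → ℝ} {ε : ℝ}
    (hD : MeasurableSet {z : X × X | ε < D z.1 z.2}) (p q : Measure X)
    [IsProbabilityMeasure p] [IsProbabilityMeasure q] : PV D p q ε ≤ 1 := by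
  simpa using PV_le_of_subcoupling hD (p := p) (q := q) 0
    (by simpa [Measure.fst] using Measure.zero_le p)
    (by simpa [Measure.snd] using Measure.zero_le q)

/-! ### Measurability of the empirical perturbed variation -/

/-- Which of the pairs of points of two samples are within distance `ε` of each other. -/
def closePairs {X : Type*} (D : X → X → ℝ) (ε : ℝ) {n m : ℕ} (x : Fin n → X) (y : Fin m → X) :
    Fin n → Fin m → Prop :=
  fun i j => D (x i) (y j) ≤ ε

theorem EmpPVFeasible.congr {X : Type*} {D : X → X → ℝ} {ε : ℝ} {n m : ℕ} {x x' : Fin n → X}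
    {y y' : Fin m → X} (h : closePairs D ε x y = closePairs D ε x' y') {w : Fin n → ℝ}
    {v : Fin m → ℝ} {Z : Fin n → Fin m → ℝ} (H : EmpPVFeasible D ε x y w v Z) :
    EmpPVFeasible D ε x' y' w v Z := by
  have h' : ∀ i j, D (x i) (y j) ≤ ε ↔ D (x' i) (y' j) ≤ ε := fun i j =>
    iff_of_eq (congrFun (congrFun h i) j)
  refine ⟨H.w_nonneg, H.v_nonneg, H.Z_nonneg, fun i => ?_, fun j => ?_, fun i j hij => ?_⟩
  · simpa only [h'] using H.row i
  · simpa only [h'] using H.col j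
  · exact H.far i j (by rwa [← not_le, h', not_le])

theorem empPV_congr {X : Type*} {D : X → X → ℝ} {ε : ℝ} {n m : ℕ} {x x' : Fin n → X}
    {y y' : Fin m → X} (h : closePairs D ε x y = closePairs D ε x' y') :
    empPV D x y ε = empPV D x' y' ε := by
  unfold empPV
  congr 1
  ext r
  exact ⟨fun ⟨w, v, Z, H, hr⟩ => ⟨w, v, Z, H.congr h, hr⟩,
    fun ⟨w, v, Z, H, hr⟩ => ⟨w, v, Z, H.congr h.symm, hr⟩⟩

theorem measurable_closePairs {X Ω : Type*} [MeasurableSpace Ω] {D : X → X → ℝ} {ε : ℝ} {n m : ℕ}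
    {x : Ω → Fin n → X} {y : Ω → Fin m → X} (h : ∀ i j, Measurable fun ω => D (x ω i) (y ω j)) :
    Measurable fun ω => closePairs D ε (x ω) (y ω) :=
  measurable_pi_lambda _ fun i => measurable_pi_lambda _ fun j =>
    measurableSet_setOfPred.1 (measurableSet_le (h i j) measurable_const)

/-- The value depends on the samples only through the pattern of close pairs, which takes finitely
many values. -/
theorem measurableSet_empPV_lt {X Ω : Type*} [MeasurableSpace Ω] {D : X → X → ℝ} {ε : ℝ} {n m : ℕ}
    {x : Ω → Fin n → X} {y : Ω → Fin m → X} (h : ∀ i j, Measurable fun ω => D (x ω i) (y ω j))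
    (t : ℝ) : MeasurableSet {ω | empPV D (x ω) (y ω) ε < t} := by
  have : {ω | empPV D (x ω) (y ω) ε < t} = (fun ω => closePairs D ε (x ω) (y ω)) ⁻¹'
      ((fun ω => closePairs D ε (x ω) (y ω)) '' {ω | empPV D (x ω) (y ω) ε < t}) := by
    refine Set.Subset.antisymm (Set.subset_preimage_image _ _) ?_
    rintro ω ⟨ω', hω', hE⟩
    rw [Set.mem_ofPred_eq] at hω' ⊢
    rwa [← empPV_congr hE]
  rw [this]
  exact measurable_closePairs h (Set.toFinite _).measurableSet

/-! ### Large fractional matchings -/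

theorem EmpPVFeasible.sum_row {X : Type*} {D : X → X → ℝ} {ε : ℝ} {n m : ℕ} {x : Fin n → X}
    {y : Fin m → X} {w : Fin n → ℝ} {v : Fin m → ℝ} {Z : Fin n → Fin m → ℝ}
    (H : EmpPVFeasible D ε x y w v Z) (i : Fin n) : ∑ j, Z i j = 1 - w i := by
  rw [← H.row i, add_sub_cancel_right, Finset.sum_filter_of_ne]
  intro j _ hj
  by_contra hc
  exact hj (H.far i j (not_le.1 hc))

theorem EmpPVFeasible.sum_col {X : Type*} {D : X → X → ℝ} {ε : ℝ} {n m : ℕ} {x : Fin n → X}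
    {y : Fin m → X} {w : Fin n → ℝ} {v : Fin m → ℝ} {Z : Fin n → Fin m → ℝ}
    (H : EmpPVFeasible D ε x y w v Z) (j : Fin m) : ∑ i, Z i j = 1 - v j := by
  rw [← H.col j, add_sub_cancel_right, Finset.sum_filter_of_ne]
  intro i _ hi
  by_contra hc
  exact hi (H.far i j (not_le.1 hc))

/-- Keep only the penalty of the larger sample: its unmatched weight is below `2t * max n m`, the 2
coming from the factor 1/2 in the objective. -/
theorem EmpPVFeasible.le_sum {X : Type*} {D : X → X → ℝ} {ε : ℝ} {n m : ℕ} (hn : 0 < n)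
    (hm : 0 < m) {x : Fin n → X}
    {y : Fin m → X} {w : Fin n → ℝ} {v : Fin m → ℝ} {Z : Fin n → Fin m → ℝ}
    (H : EmpPVFeasible D ε x y w v Z) {t : ℝ}
    (ht : 1 / (2 * (n : ℝ)) * ∑ i, w i + 1 / (2 * (m : ℝ)) * ∑ j, v j < t) :
    (1 - 2 * t) * (max n m : ℕ) ≤ ∑ i, ∑ j, Z i j := by
  have hw : 0 ≤ ∑ i, w i := Finset.sum_nonneg fun i _ => H.w_nonneg i
  have hv : 0 ≤ ∑ j, v j := Finset.sum_nonneg fun j _ => H.v_nonneg j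
  have h1 : ∑ i, ∑ j, Z i j = n - ∑ i, w i := by
    simp [H.sum_row]
  have h2 : ∑ i, ∑ j, Z i j = m - ∑ j, v j := by
    rw [Finset.sum_comm]; simp [H.sum_col]
  have hn' : (0 : ℝ) < n := by exact_mod_cast hn
  have hm' : (0 : ℝ) < m := by exact_mod_cast hm
  have hw' : 0 ≤ 1 / (2 * (n : ℝ)) * ∑ i, w i := by positivity
  have hv' : 0 ≤ 1 / (2 * (m : ℝ)) * ∑ j, v j := by positivity
  rcases le_total n m with h | h
  · rw [max_eq_right h, h2]
    have : 1 / (2 * (m : ℝ)) * ∑ j, v j < t := by linarith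
    rw [one_div_mul_eq_div, div_lt_iff₀ (by positivity)] at this
    linarith
  · rw [max_eq_left h, h1]
    have : 1 / (2 * (n : ℝ)) * ∑ i, w i < t := by linarith
    rw [one_div_mul_eq_div, div_lt_iff₀ (by positivity)] at this
    linarith

theorem empPV_set_nonempty {X : Type*} (D : X → X → ℝ) (ε : ℝ) {n m : ℕ} (x : Fin n → X)
    (y : Fin m → X) : {r | ∃ w v Z, EmpPVFeasible D ε x y w v Z ∧
    r = 1 / (2 * (n : ℝ)) * ∑ i, w i + 1 / (2 * (m : ℝ)) * ∑ j, v j}.Nonempty :=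
  ⟨_, fun _ => 1, fun _ => 1, fun _ _ => 0, ⟨by simp, by simp, by simp, by simp, by simp, by simp⟩,
    rfl⟩

/-- A fractional matching of close pairs, which is large if the empirical perturbed variation is
below `t`. -/
theorem exists_matching {X : Type*} (D : X → X → ℝ) (ε : ℝ) {n m : ℕ} (hn : 0 < n) (hm : 0 < m)
    (x : Fin n → X) (y : Fin m → X) (t : ℝ) :
    ∃ Z : Fin n → Fin m → ENNReal, (∀ i, ∑ j, Z i j ≤ 1) ∧ (∀ j, ∑ i, Z i j ≤ 1) ∧
      (∀ i j, ¬ closePairs D ε x y i j → Z i j = 0) ∧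
      (empPV D x y ε < t → ENNReal.ofReal (1 - 2 * t) * (max n m : ℕ) ≤ ∑ i, ∑ j, Z i j) := by
  by_cases h : empPV D x y ε < t
  · obtain ⟨r, ⟨w, v, Z, H, rfl⟩, hr⟩ := exists_lt_of_csInf_lt (empPV_set_nonempty D ε x y) h
    refine ⟨fun i j => ENNReal.ofReal (Z i j), fun i => ?_, fun j => ?_, fun i j hij => ?_,
      fun _ => ?_⟩
    · rw [← ENNReal.ofReal_sum_of_nonneg fun j _ => H.Z_nonneg i j, H.sum_row,
        ENNReal.ofReal_le_one]
      linarith [H.w_nonneg i]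
    · rw [← ENNReal.ofReal_sum_of_nonneg fun i _ => H.Z_nonneg i j, H.sum_col,
        ENNReal.ofReal_le_one]
      linarith [H.v_nonneg j]
    · simp [H.far i j (not_le.1 hij)]
    · simp_rw [← ENNReal.ofReal_sum_of_nonneg fun j _ => H.Z_nonneg _ j]
      rw [← ENNReal.ofReal_sum_of_nonneg fun i _ => Finset.sum_nonneg fun j _ => H.Z_nonneg i j,
        ← ENNReal.ofReal_natCast, ← ENNReal.ofReal_mul' (Nat.cast_nonneg _)]
      exact ENNReal.ofReal_le_ofReal (H.le_sum hn hm hr)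
  · exact ⟨0, by simp, by simp, by simp, fun h' => absurd h' h⟩

/-- Choosing the matching by the pattern `B` rather than by the samples makes it a measurable
function of the samples. -/
theorem exists_matching_of_closePairs {X : Type*} (D : X → X → ℝ) (ε : ℝ) {n m : ℕ} (hn : 0 < n)
    (hm : 0 < m) (t : ℝ) (B : Fin n → Fin m → Prop) :
    ∃ Z : Fin n → Fin m → ENNReal, (∀ i, ∑ j, Z i j ≤ 1) ∧ (∀ j, ∑ i, Z i j ≤ 1) ∧
      (∀ i j, ¬ B i j → Z i j = 0) ∧
      ∀ x y, closePairs D ε x y = B → empPV D x y ε < t →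
        ENNReal.ofReal (1 - 2 * t) * (max n m : ℕ) ≤ ∑ i, ∑ j, Z i j := by
  by_cases h : ∃ x y, closePairs D ε x y = B
  · obtain ⟨x, y, rfl⟩ := h
    obtain ⟨Z, h1, h2, h3, h4⟩ := exists_matching D ε hn hm x y t
    exact ⟨Z, h1, h2, h3, fun x' y' hB ht => h4 (by rwa [← empPV_congr hB])⟩
  · exact ⟨0, by simp, by simp, by simp, fun x y hB => absurd ⟨x, y, hB⟩ h⟩

/-! ### Gluing matchings into a partial coupling -/

theorem measurable_sample_pair {X : Type*} [MeasurableSpace X] {D : X → X → ℝ}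
    (hD : Measurable (Function.uncurry D)) {n m : ℕ} (i : Fin n) (j : Fin m) :
    Measurable fun z : (Fin n → X) × (Fin m → X) => D (z.1 i) (z.2 j) := by
  have h : Measurable fun z : (Fin n → X) × (Fin m → X) => (z.1 i, z.2 j) := by fun_prop
  exact hD.comp h

/-- Gluing the optimal matchings of the samples into a partial coupling of `p` and `q` bounds the
perturbed variation by means of the law of its empirical version. -/
theorem PV_le_of_measure_empPV_lt {X : Type*} [MeasurableSpace X] {D : X → X → ℝ}
    (hD : Measurable (Function.uncurry D)) {ε : ℝ} {n m : ℕ} (hn : 0 < n) (hm : 0 < m)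
    (p q : Measure X) [IsProbabilityMeasure p] [IsProbabilityMeasure q] {t : ℝ} (ht : 2 * t ≤ 1) :
    PV D p q ε ≤ 1 - (1 - 2 * t) *
      ((Measure.pi fun _ : Fin n => p).prod (Measure.pi fun _ : Fin m => q)).real
        {z | empPV D z.1 z.2 ε < t} := by
  set ν := (Measure.pi fun _ : Fin n => p).prod (Measure.pi fun _ : Fin m => q)
  choose Z hrow hcol hZ hbig using fun B => exists_matching_of_closePairs D ε hn hm t B
  set b : (Fin n → X) × (Fin m → X) → Fin n → Fin m → Prop :=
    fun z => closePairs D ε z.1 z.2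
  have hDij : ∀ i j, Measurable fun z : (Fin n → X) × (Fin m → X) => D (z.1 i) (z.2 j) :=
    measurable_sample_pair hD
  have hb : Measurable b := measurable_closePairs hDij
  have hZb : ∀ i j, Measurable fun z => Z (b z) i j := fun i j =>
    (measurable_of_countable fun B => Z B i j).comp hb
  have hx : ∀ i, Measurable fun z : (Fin n → X) × (Fin m → X) => z.1 i :=
    fun i => (measurable_pi_apply i).comp measurable_fst
  have hy : ∀ j, Measurable fun z : (Fin n → X) × (Fin m → X) => z.2 j :=
    fun j => (measurable_pi_apply j).comp measurable_snd
  have hxp : ∀ i, ∀ s, MeasurableSet s → ν ((fun z => z.1 i) ⁻¹' s) = p s := fun i s hs =>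
    ((measurePreserving_eval (fun _ : Fin n => p) i).comp
      measurePreserving_fst).measure_preimage hs.nullMeasurableSet
  have hyq : ∀ j, ∀ s, MeasurableSet s → ν ((fun z => z.2 j) ⁻¹' s) = q s := fun j s hs =>
    ((measurePreserving_eval (fun _ : Fin m => q) j).comp
      measurePreserving_snd).measure_preimage hs.nullMeasurableSet
  have hM0 : ((max n m : ℕ) : ENNReal) ≠ 0 := by
    exact_mod_cast (lt_max_of_lt_left hn).ne'
  have hMtop : ((max n m : ℕ) : ENNReal) ≠ ⊤ := ENNReal.natCast_ne_top _
  set M : ENNReal := ((max n m : ℕ) : ENNReal) with hM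
  -- The expected matching. Row sums at most 1 bound its first marginal by `(n / M) • p`, column
  -- sums its second by `(m / M) • q`; dividing by the maximum keeps both below `p` and `q`.
  let μ₀ : Measure (X × X) := M⁻¹ • ∑ i, ∑ j,
    (ν.withDensity fun z => Z (b z) i j).map fun z => (z.1 i, z.2 j)
  have hμ₀ : ∀ s, MeasurableSet s → μ₀ s = M⁻¹ * ∑ i, ∑ j,
      ∫⁻ z in (fun z => (z.1 i, z.2 j)) ⁻¹' s, Z (b z) i j ∂ν := by
    intro s hs
    simp only [μ₀, Measure.smul_apply, Measure.finsetSum_apply, smul_eq_mul]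
    congr 1
    refine Finset.sum_congr rfl fun i _ => Finset.sum_congr rfl fun j _ => ?_
    rw [Measure.map_apply ((hx i).prodMk (hy j)) hs,
      withDensity_apply _ ((hx i).prodMk (hy j) hs)]
  have h1 : μ₀.fst ≤ p := by
    refine Measure.le_iff.2 fun s hs => ?_
    rw [Measure.fst_apply hs, hμ₀ _ (measurable_fst hs)]
    have : ∀ i, ∑ j, ∫⁻ z in (fun z : (Fin n → X) × (Fin m → X) => (z.1 i, z.2 j)) ⁻¹'
        (Prod.fst ⁻¹' s), Z (b z) i j ∂ν ≤ p s := by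
      intro i
      change ∑ j, ∫⁻ z in (fun z => z.1 i) ⁻¹' s, Z (b z) i j ∂ν ≤ p s
      rw [← lintegral_finsetSum _ fun j _ => hZb i j, ← hxp i s hs, ← setLIntegral_one]
      exact lintegral_mono fun z => hrow _ i
    calc _ ≤ M⁻¹ * ∑ i : Fin n, p s := by gcongr with i; exact this i
      _ = M⁻¹ * (n * p s) := by simp
      _ ≤ M⁻¹ * (M * p s) := by
        gcongr
        exact Nat.cast_le.2 (le_max_left n m)
      _ = p s := by rw [← mul_assoc, ENNReal.inv_mul_cancel hM0 hMtop, one_mul]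
  have h2 : μ₀.snd ≤ q := by
    refine Measure.le_iff.2 fun s hs => ?_
    rw [Measure.snd_apply hs, hμ₀ _ (measurable_snd hs), Finset.sum_comm]
    have : ∀ j, ∑ i, ∫⁻ z in (fun z : (Fin n → X) × (Fin m → X) => (z.1 i, z.2 j)) ⁻¹'
        (Prod.snd ⁻¹' s), Z (b z) i j ∂ν ≤ q s := by
      intro j
      change ∑ i, ∫⁻ z in (fun z => z.2 j) ⁻¹' s, Z (b z) i j ∂ν ≤ q s
      rw [← lintegral_finsetSum _ fun i _ => hZb i j, ← hyq j s hs, ← setLIntegral_one]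
      exact lintegral_mono fun z => hcol _ j
    calc _ ≤ M⁻¹ * ∑ j : Fin m, q s := by gcongr with j; exact this j
      _ = M⁻¹ * (m * q s) := by simp
      _ ≤ M⁻¹ * (M * q s) := by
        gcongr
        exact Nat.cast_le.2 (le_max_right n m)
      _ = q s := by rw [← mul_assoc, ENNReal.inv_mul_cancel hM0 hMtop, one_mul]
  have hfar : MeasurableSet {z : X × X | ε < D z.1 z.2} := measurableSet_lt measurable_const hD
  have hF : MeasurableSet {z : (Fin n → X) × (Fin m → X) | empPV D z.1 z.2 ε < t} :=
    measurableSet_empPV_lt hDij t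
  have hmass : ENNReal.ofReal (1 - 2 * t) * ν {z | empPV D z.1 z.2 ε < t} ≤
      μ₀ {z | ε < D z.1 z.2}ᶜ := by
    rw [hμ₀ _ hfar.compl]
    -- The matching vanishes off close pairs, so the restriction loses nothing.
    have hset : ∀ i j, ∫⁻ z in (fun z : (Fin n → X) × (Fin m → X) => (z.1 i, z.2 j)) ⁻¹'
        {z | ε < D z.1 z.2}ᶜ, Z (b z) i j ∂ν = ∫⁻ z, Z (b z) i j ∂ν := by
      intro i j
      refine setLIntegral_eq_of_support_subset fun z hz => ?_
      by_contra hc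
      exact hz (hZ _ i j fun hcl => hc (not_lt.2 hcl))
    simp_rw [hset]
    simp_rw [← lintegral_finsetSum _ fun j _ => hZb _ j]
    rw [← lintegral_finsetSum _ fun i _ => Finset.measurable_fun_sum _ fun j _ => hZb i j]
    calc _ = M⁻¹ * ((ENNReal.ofReal (1 - 2 * t) * M) * ν {z | empPV D z.1 z.2 ε < t}) := by
          rw [mul_comm _ M, mul_assoc, ← mul_assoc, ENNReal.inv_mul_cancel hM0 hMtop, one_mul]
      _ = M⁻¹ * ∫⁻ z in {z | empPV D z.1 z.2 ε < t}, ENNReal.ofReal (1 - 2 * t) * M ∂ν := by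
          rw [setLIntegral_const]
      _ ≤ M⁻¹ * ∫⁻ z in {z | empPV D z.1 z.2 ε < t}, ∑ i, ∑ j, Z (b z) i j ∂ν := by
          gcongr M⁻¹ * ?_
          exact setLIntegral_mono' hF fun z hz => hbig _ _ _ rfl hz
      _ ≤ _ := by
          gcongr M⁻¹ * ?_
          exact setLIntegral_le_lintegral _ _
  have hfin : μ₀ {z | ε < D z.1 z.2}ᶜ ≠ ⊤ := by
    refine ne_top_of_le_ne_top (measure_ne_top p Set.univ)
      ((measure_mono (Set.subset_univ _)).trans ?_)
    rw [← Measure.fst_univ]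
    exact h1 _
  have := ENNReal.toReal_mono hfin hmass
  rw [ENNReal.toReal_mul, ENNReal.toReal_ofReal (by linarith)] at this
  exact (PV_le_of_subcoupling hfar μ₀ h1 h2).trans (sub_le_sub_left this 1)

/-! ### Projected samples -/

theorem measurable_absDist : Measurable (Function.uncurry absDist) := by
  unfold absDist Function.uncurry
  fun_prop

/-- The law of the empirical perturbed variation of the projected samples is governed by the
perturbed variation of the projections. -/
theorem projPV_le_of_measure_empPV_lt {E : Type*} [MeasurableSpace E] (P Q : Measure E)
    [IsProbabilityMeasure P] [IsProbabilityMeasure Q] {ε : ℝ} {g : E → ℝ} (hg : Measurable g)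
    {n m : ℕ} (hn : 0 < n) (hm : 0 < m) {t : ℝ} (ht : 2 * t ≤ 1) :
    projPV P Q ε g ≤ 1 - (1 - 2 * t) *
      ((Measure.pi fun _ : Fin n => P).prod (Measure.pi fun _ : Fin m => Q)).real
        {z | empPV absDist (fun i => g (z.1 i)) (fun j => g (z.2 j)) ε < t} := by
  have := Measure.isProbabilityMeasure_map (μ := P) hg.aemeasurable
  have := Measure.isProbabilityMeasure_map (μ := Q) hg.aemeasurable
  -- Projecting i.i.d. samples gives i.i.d. samples from the image laws.
  have hmp : MeasurePreserving
      (Prod.map (fun (x : Fin n → E) i => g (x i)) (fun (y : Fin m → E) j => g (y j)))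
      ((Measure.pi fun _ : Fin n => P).prod (Measure.pi fun _ : Fin m => Q))
      ((Measure.pi fun _ : Fin n => P.map g).prod (Measure.pi fun _ : Fin m => Q.map g)) :=
    (measurePreserving_pi _ _ fun _ => ⟨hg, rfl⟩).prod (measurePreserving_pi _ _ fun _ => ⟨hg, rfl⟩)
  have hF : MeasurableSet {z : (Fin n → ℝ) × (Fin m → ℝ) | empPV absDist z.1 z.2 ε < t} :=
    measurableSet_empPV_lt (x := Prod.fst) (y := Prod.snd)
      (measurable_sample_pair measurable_absDist) t
  have h := PV_le_of_measure_empPV_lt measurable_absDist (ε := ε) hn hm (P.map g) (Q.map g) ht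
  rw [← hmp.measureReal_preimage hF.nullMeasurableSet] at h
  exact h

theorem projPV_nonneg {E : Type*} [MeasurableSpace E] (P Q : Measure E) (ε : ℝ) (g : E → ℝ) :
    0 ≤ projPV P Q ε g :=
  PV_nonneg _ _ _ _

theorem projPV_le_one {E : Type*} [MeasurableSpace E] (P Q : Measure E)
    [IsProbabilityMeasure P] [IsProbabilityMeasure Q] {ε : ℝ} {g : E → ℝ} (hg : Measurable g) :
    projPV P Q ε g ≤ 1 := by
  have := Measure.isProbabilityMeasure_map (μ := P) hg.aemeasurable
  have := Measure.isProbabilityMeasure_map (μ := Q) hg.aemeasurable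
  exact PV_le_one (measurableSet_lt measurable_const measurable_absDist) _ _

/-- If `projPV` vanishes for almost all mappings, then so do the scores along an i.i.d. sequence
of mappings. -/
theorem ae_PPV_eq_zero {E Θ : Type*} [MeasurableSpace E] [MeasurableSpace Θ] {P Q : Measure E}
    {ε : ℝ} {ρ : Measure Θ} [IsProbabilityMeasure ρ] {f : Θ → E → ℝ}
    (h : ∀ᵐ θ ∂ρ, projPV P Q ε (f θ) = 0) :
    ∀ᵐ θ ∂(Measure.infinitePi fun _ : ℕ => ρ), ∀ K, PPV P Q ε (fun i => f (θ i)) K = 0 := by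
  have : ∀ᵐ θ ∂(Measure.infinitePi fun _ : ℕ => ρ), ∀ i, projPV P Q ε (f (θ i)) = 0 :=
    ae_all_iff.2 fun i =>
      (measurePreserving_eval_infinitePi (fun _ : ℕ => ρ) i).quasiMeasurePreserving.ae h
  filter_upwards [this] with θ hθ K
  simp [PPV, hθ]

/-! ### Random projections and repeated trials -/

/-- A bound for the probability of an event whose conditional probability, given the
first coordinate, is at most `c` with probability at least `a`. -/
theorem prod_real_le {Θ Y : Type*} [MeasurableSpace Θ] [MeasurableSpace Y] (ρ : Measure Θ)
    [IsProbabilityMeasure ρ] (ν : Measure Y) [IsProbabilityMeasure ν] {F : Set (Θ × Y)}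
    (hF : MeasurableSet F) {A : Set Θ} {c : ℝ} (hc : c ≤ 1)
    (hA : ∀ θ ∈ A, ν.real (Prod.mk θ ⁻¹' F) ≤ c) :
    (ρ.prod ν).real F ≤ 1 - ρ.real A * (1 - c) := by
  have hm : Measurable fun θ => ν.real (Prod.mk θ ⁻¹' F) :=
    (measurable_measure_prodMk_left hF).ennreal_toReal
  -- `A` need not be measurable, so it is enlarged to the measurable set where the bound `c` holds.
  have hA' : MeasurableSet {θ | ν.real (Prod.mk θ ⁻¹' F) ≤ c} :=
    measurableSet_le hm measurable_const
  set A' := {θ | ν.real (Prod.mk θ ⁻¹' F) ≤ c}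
  have hAA' : ρ.real A ≤ ρ.real A' := measureReal_mono hA
  have hint : Integrable (fun θ => ν.real (Prod.mk θ ⁻¹' F)) ρ :=
    Integrable.of_bound hm.aestronglyMeasurable 1 (Eventually.of_forall fun θ => by
      rw [Real.norm_of_nonneg measureReal_nonneg]; exact measureReal_le_one)
  have heq : (ρ.prod ν).real F = ∫ θ, ν.real (Prod.mk θ ⁻¹' F) ∂ρ := by
    rw [integral_eq_lintegral_of_nonneg_ae (Eventually.of_forall fun _ => measureReal_nonneg)
      hm.aestronglyMeasurable, Measure.real, Measure.prod_apply hF]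
    simp
  rw [heq]
  calc ∫ θ, ν.real (Prod.mk θ ⁻¹' F) ∂ρ
      ≤ ∫ θ, (1 - A'.indicator (fun _ => 1 - c) θ) ∂ρ := by
        refine integral_mono hint ((integrable_const _).sub
          ((integrable_const _).indicator hA')) fun θ => ?_
        by_cases hθ : θ ∈ A'
        · rw [Set.indicator_of_mem hθ, sub_sub_cancel]
          exact hθ
        · rw [Set.indicator_of_notMem hθ, sub_zero]
          exact measureReal_le_one
    _ = 1 - ρ.real A' * (1 - c) := by
        rw [integral_sub (integrable_const _) ((integrable_const _).indicator hA'),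
          integral_indicator_const _ hA']
        simp
    _ ≤ 1 - ρ.real A * (1 - c) := by nlinarith

/-- The best of `K` independent trials fails only if all of them do. -/
theorem one_sub_pow_le_measure_pi {Ω : Type*} [MeasurableSpace Ω] (τ : Measure Ω)
    [IsProbabilityMeasure τ] {F : Set Ω} (hF : MeasurableSet F) {K : ℕ} {r : ℝ}
    (hr : τ.real F ≤ r) :
    1 - r ^ K ≤ (Measure.pi fun _ : Fin K => τ).real (Set.univ.pi fun _ => F)ᶜ := by
  rw [probReal_compl_eq_one_sub (MeasurableSet.univ_pi fun _ => hF), Measure.real, Measure.pi_pi,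
    Finset.prod_const, Finset.card_univ, Fintype.card_fin, ENNReal.toReal_pow]
  gcongr
  exact hr

theorem theorem10 {d : ℕ} (D : (Fin d → ℝ) → (Fin d → ℝ) → ℝ)
    (P Q : Measure (Fin d → ℝ)) [IsProbabilityMeasure P] [IsProbabilityMeasure Q]
    (hP : P (Set.Icc 0 1) = 1) (hQ : Q (Set.Icc 0 1) = 1)
    (ε : ℝ) (hε : ε ∈ Set.Ioo (0 : ℝ) 1)
    {Θ : Type*} [MeasurableSpace Θ] (ρ : Measure Θ) [IsProbabilityMeasure ρ]
    (f : Θ → (Fin d → ℝ) → ℝ) (hf : Measurable (Function.uncurry f))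
    (h : OneDimDistinguishable D P Q ε ρ f) :
    0 < essSup (fun θ => projPV P Q ε (f θ)) ρ ∧
    ∀ t : ℝ, 2 * t < essSup (fun θ => projPV P Q ε (f θ)) ρ →
      ∃ q ∈ Set.Ioo (0 : ℝ) 1, ∀ K n m : ℕ, 0 < K → 0 < n → 0 < m →
        ∀ δ ∈ Set.Ioo (0 : ℝ) 1, threshold ε K n m δ ≤ t →
          q - q * δ + δ ∈ Set.Ioo (0 : ℝ) 1 ∧
          1 - (q - q * δ + δ) ^ K ≤
            (Measure.pi fun _ : Fin K => trialLaw P Q ρ n m).real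
              {ω | threshold ε K n m δ ≤
                empPPV (fun i => f (ω i).1) (fun i => (ω i).2.1) (fun i => (ω i).2.2) ε} := by
  have hfm : ∀ θ, Measurable (f θ) := fun θ => hf.comp measurable_prodMk_left
  have hle1 : ∀ θ, projPV P Q ε (f θ) ≤ 1 := fun θ => projPV_le_one P Q (hfm θ)
  have hbdd : IsBoundedUnder (· ≤ ·) (ae ρ) fun θ => projPV P Q ε (f θ) :=
    isBoundedUnder_of ⟨1, hle1⟩
  have hbdd' : IsBoundedUnder (· ≥ ·) (ae ρ) fun θ => projPV P Q ε (f θ) :=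
    isBoundedUnder_of ⟨0, fun θ => projPV_nonneg P Q ε (f θ)⟩
  constructor
  · by_contra hL
    -- Scores are nonnegative, so `L ≤ 0` would make almost all of them zero and force the limit of
    -- the maxima to be zero.
    have h0 : ∀ᵐ θ ∂ρ, projPV P Q ε (f θ) = 0 := by
      filter_upwards [ae_le_essSup hbdd] with θ hθ
      exact le_antisymm (hθ.trans (not_lt.1 hL)) (projPV_nonneg P Q ε (f θ))
    obtain ⟨θ, h1, l, hl, hlim⟩ := ((ae_PPV_eq_zero h0).and h.2).exists
    simp only [h1] at hlim
    exact hl.ne (tendsto_nhds_unique tendsto_const_nhds hlim)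
  · intro t ht
    obtain ⟨s, hts, hs⟩ := exists_between ht
    have hL1 : essSup (fun θ => projPV P Q ε (f θ)) ρ ≤ 1 :=
      essSup_le_of_ae_le 1 (Eventually.of_forall hle1) hbdd'.isCoboundedUnder_le
    set A : Set Θ := {θ | s < projPV P Q ε (f θ)}
    have hfreq : ∃ᶠ θ in ae ρ, s < projPV P Q ε (f θ) :=
      frequently_lt_of_lt_limsup hbdd'.isCoboundedUnder_le hs
    have hApos : 0 < ρ.real A :=
      ENNReal.toReal_pos (frequently_ae_iff.1 hfreq) (measure_ne_top _ _)
    have hAle : ρ.real A ≤ 1 := measureReal_le_one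
    -- Solves `s = 1 - (1 - 2t) * c`; here `2t < s < L ≤ 1` gives `0 < c < 1`.
    set c := (1 - s) / (1 - 2 * t) with hc
    have hc0 : 0 < c := div_pos (by linarith) (by linarith)
    have hc1 : c < 1 := (div_lt_one (by linarith)).2 (by linarith)
    set q := 1 - ρ.real A * (1 - c)
    have hq0 : 0 < q := by nlinarith
    have hq1 : q < 1 := by nlinarith
    refine ⟨q, ⟨hq0, hq1⟩, fun K n m hK hn hm δ hδ hη => ⟨⟨?_, ?_⟩, ?_⟩⟩
    · nlinarith [hδ.1, hδ.2]
    · nlinarith [hδ.1, hδ.2]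
    have hf' : ∀ i j, Measurable fun w : Θ × (Fin n → Fin d → ℝ) × (Fin m → Fin d → ℝ) =>
        absDist (f w.1 (w.2.1 i)) (f w.1 (w.2.2 j)) := by
      intro i j
      have h1 : Measurable fun w : Θ × (Fin n → Fin d → ℝ) × (Fin m → Fin d → ℝ) =>
        (w.1, w.2.1 i) := by fun_prop
      have h2 : Measurable fun w : Θ × (Fin n → Fin d → ℝ) × (Fin m → Fin d → ℝ) =>
        (w.1, w.2.2 j) := by fun_prop
      exact measurable_absDist.comp ((hf.comp h1).prodMk (hf.comp h2))
    set F : Set (Θ × (Fin n → Fin d → ℝ) × (Fin m → Fin d → ℝ)) :=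
      {w | empPV absDist (fun i => f w.1 (w.2.1 i)) (fun j => f w.1 (w.2.2 j)) ε < t}
    have hF : MeasurableSet F := measurableSet_empPV_lt hf' t
    have hFq : (trialLaw P Q ρ n m).real F ≤ q := by
      refine prod_real_le ρ _ hF (A := A) hc1.le fun θ hθ => ?_
      have h1 := projPV_le_of_measure_empPV_lt P Q (ε := ε) (hfm θ) hn hm (t := t) (by linarith)
      have h2 : s < projPV P Q ε (f θ) := hθ
      rw [hc, le_div_iff₀ (by linarith)]
      have h3 := h2.trans_le h1
      change s < 1 - (1 - 2 * t) * Measure.real _ (Prod.mk θ ⁻¹' F) at h3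
      linarith
    have : IsProbabilityMeasure (trialLaw P Q ρ n m) := by
      unfold trialLaw; infer_instance
    refine (one_sub_pow_le_measure_pi (trialLaw P Q ρ n m) hF
      (hFq.trans (by nlinarith [hδ.1] : q ≤ q - q * δ + δ))).trans (measureReal_mono ?_)
    -- One trial with value at least `t` already lifts the maximum above the threshold.
    intro ω hω
    simp only [Set.mem_compl_iff, Set.mem_univ_pi, not_forall] at hω
    obtain ⟨i, hi⟩ := hω
    exact (hη.trans (not_lt.1 hi)).trans
      (le_ciSup (f := fun i => empPV absDist (fun j => f (ω i).1 ((ω i).2.1 j))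
        (fun j => f (ω i).1 ((ω i).2.2 j)) ε) (Set.finite_range _).bddAbove i)
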